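/- Let $G=(V,E)$ be a directed graph on $p\ge 2$ nodes, self-loops allowed, that is a (possibly disconnected) polytree: after removing the self-loops, $G$ has no directed cycle and its underlying undirected graph has no cycle. Assume that no node is isolated (every node is joined by an edge to another node) and that every source (node with no incoming edge from another node) has a self-loop; other self-loops are optional. Consider the fourth-order discrete Lyapunov model of $G$. Its parameters are a real matrix $A$ with $a_{ji}=0$ whenever $i\to j\notin E$, all of whose complex eigenvalues have absolute value less than $1$, and vectors $\omega^{(2)}\in\mathbb R_{>0}^V$, $\omega^{(3)}\in(\mathbb R\setminus\{0\})^V$, $\omega^{(4)}\in\mathbb R_{>0}^V$, which are the diagonals of diagonal tensors $\Omega^{(2)},\Omega^{(3)},\Omega^{(4)}$. Let $\Theta\subseteq\mathbb R^{E}\times\mathbb R^V\times\mathbb R^V\times\mathbb R^V$ be the set of all parameters, and let $\varphi:\Theta\to\{(S,T,R)\}$ send a parameter to the steady-state cumulants $S=T_2$, $T=T_3$, $R=T_4$, where $$T_m=\sum_{i=0}^\infty \Omega^{(m)}\times_1A^i\times_2\cdots\times_mA^i ,\qquad\text{i.e.}\qquad (T_m)_{k_1\ldots k_m}=\sum_{i=0}^\infty\sum_{v\in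 V}\omega^{(m)}_v\,(A^i)_{k_1v}\cdots(A^i)_{k_mv}.$$ A property holds generically if it holds for all $\theta\in\Theta\setminus Z$ for some $Z\subsetneq\Theta$ that is the set of common zeros in $\Theta$ of a family of real polynomials in the parameters. Then: 1. $A$ is generically identifiable: for generic $\theta\in\Theta$, every $\theta'\in\Theta$ with $\varphi(\theta')=\varphi(\theta)$ has the same matrix $A$ as $\theta$. 2. Hence the error cumulants are generically identifiable too: for generic $\theta\in\Theta$, $\varphi^{-1}(\varphi(\theta))=\{\theta\}$. 3. For generic $\theta\in\Theta$ the following holds for every node $j$ that is not a source. Let $i_1,\dots,i_d$ be the parents of $j$ other than $j$, in any order, and for each $k$ let $e_k$ be any source with a directed path (possibly of length $0$) to $i_k$. Then the weights of the edges into $j$, namely $x_k=a_{ji_k}$ $(1\le k\le d)$ and $y=a_{jj}$ (with $y=0$ if $j$ has no self-loop), are the unique real solution of the linear system $$s_{e_kj}=a_{e_ke_k}s_{e_ki_k}\,x_k+a_{e_ke_k}s_{e_kj}\,y\quad(1\le k\le d),\qquad t_{e_1e_1j}=a_{e_1e_1}^2t_{e_1e_1i_1}\,x_1+a_{e_1e_1}^2t_{e_1e_1j}\,y,$$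 where the last equation is present only if $j$ has a self-loop, and $y$ is set to $0$ otherwise. -/

import Mathlib

/-! ### Directed graphs with self-loops: `G.Adj i j` means `i → j` -/

section Graphs

variable {V : Type*}

/-- A directed graph, in which self-loops are allowed, is a (possibly disconnected) polytree if,
after removal of the self-loops, it has no directed cycle and its underlying undirected graph
has no cycle. -/
def Digraph.IsPolytree (G : Digraph V) : Prop :=
  (∀ v, ¬ Relation.TransGen (fun a b => a ≠ b ∧ G.Adj a b) v v) ∧
    G.toSimpleGraphInclusive.IsAcyclic

/-- No node is isolated: every node is joined by an edge to some other node. -/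
def Digraph.NoIsolatedNodes (G : Digraph V) : Prop :=
  ∀ v, ∃ w, w ≠ v ∧ (G.Adj v w ∨ G.Adj w v)

/-- A source is a node without incoming edges from other nodes. -/
def Digraph.IsSource (G : Digraph V) (v : V) : Prop :=
  ∀ u, G.Adj u v → u = v

/-- There is a directed path (possibly of length zero) from `u` to `v`. -/
def Digraph.IsAncestor (G : Digraph V) (u v : V) : Prop :=
  Relation.ReflTransGen G.Adj u v

end Graphs

/-! ### Tensors and the discrete Lyapunov equations -/

section Lyapunov

variable {V : Type*} [Fintype V] [DecidableEq V]

/-- Real tensors of order `n` with all index sets equal to `V`. -/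
abbrev CumulantTensor (V : Type*) (n : ℕ) : Type _ := (Fin n → V) → ℝ

/-- The diagonal tensor of order `n ≥ 1` with diagonal entries `w`. -/
def diagonalTensor (n : ℕ) (w : V → ℝ) : CumulantTensor V n :=
  fun k => ∑ v, if k = (fun _ => v) then w v else 0

/-- The product `T ×₁ A ×₂ A ⋯ ×ₙ A` of a tensor with a matrix along every mode. -/
def tuckerProduct {n : ℕ} (T : CumulantTensor V n) (A : Matrix V V ℝ) : CumulantTensor V n :=
  fun k => ∑ l : Fin n → V, T l * ∏ m, A (k m) (l m)

/-- The `n`th cumulant of the steady state, `∑ᵢ Ω ×₁ Aⁱ ×₂ ⋯ ×ₙ Aⁱ` for the diagonal error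
cumulant `Ω` with diagonal `w`. It is used for Schur stable `A` and `n ≥ 2` only, and then the
series converges absolutely. -/
noncomputable def steadyCumulant (n : ℕ) (A : Matrix V V ℝ) (w : V → ℝ) : CumulantTensor V n :=
  fun k => ∑' i : ℕ, tuckerProduct (diagonalTensor n w) (A ^ i) k

/-- All complex eigenvalues have absolute value less than one. -/
def SchurStable (A : Matrix V V ℝ) : Prop :=
  ∀ z ∈ spectrum ℂ (A.map (algebraMap ℝ ℂ)), ‖z‖ < 1

end Lyapunov

/-! ### Parameters of the fourth-order model -/

section Parameters

variable {V : Type*}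

/-- The coordinates of the parameter space: one for each edge of `G`, and one for each node and
each of the orders 2, 3, 4 of the error cumulants. -/
inductive LyapunovCoord (G : Digraph V) : Type _
  | edge (i j : V) (h : G.Adj i j)
  | omega2 (v : V)
  | omega3 (v : V)
  | omega4 (v : V)

/-- The ambient real coordinate space of the parameters. -/
abbrev LyapunovParam (G : Digraph V) : Type _ := LyapunovCoord G → ℝ

open Classical in
/-- The edge weight matrix: `a_{ji}` is the weight of the edge `i → j`, and zero if there is no
such edge. -/
noncomputable def LyapunovParam.A {G : Digraph V} (θ : LyapunovParam G) : Matrix V V ℝ :=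
  Matrix.of fun j i => if h : G.Adj i j then θ (.edge i j h) else 0

/-- The diagonal of the second error cumulant. -/
def LyapunovParam.ω2 {G : Digraph V} (θ : LyapunovParam G) : V → ℝ := fun v => θ (.omega2 v)

/-- The diagonal of the third error cumulant. -/
def LyapunovParam.ω3 {G : Digraph V} (θ : LyapunovParam G) : V → ℝ := fun v => θ (.omega3 v)

/-- The diagonal of the fourth error cumulant. -/
def LyapunovParam.ω4 {G : Digraph V} (θ : LyapunovParam G) : V → ℝ := fun v => θ (.omega4 v)

variable [Fintype V] [DecidableEq V]

/-- The parameter set of the fourth-order discrete Lyapunov model: stable edge weight matrices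
supported on `G`, positive second, nonzero third and positive fourth error cumulants. -/
def lyapunovParamSet (G : Digraph V) : Set (LyapunovParam G) :=
  {θ | SchurStable (LyapunovParam.A θ) ∧ (∀ v, 0 < LyapunovParam.ω2 θ v) ∧
    (∀ v, LyapunovParam.ω3 θ v ≠ 0) ∧ ∀ v, 0 < LyapunovParam.ω4 θ v}

/-- The parametrization: the second, third and fourth cumulants `(S, T, R)` of the steady state. -/
noncomputable def lyapunovMap (G : Digraph V) (θ : LyapunovParam G) :
    CumulantTensor V 2 × CumulantTensor V 3 × CumulantTensor V 4 :=
  (steadyCumulant 2 (LyapunovParam.A θ) (LyapunovParam.ω2 θ),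
    steadyCumulant 3 (LyapunovParam.A θ) (LyapunovParam.ω3 θ),
    steadyCumulant 4 (LyapunovParam.A θ) (LyapunovParam.ω4 θ))

end Parameters

/-! ### Generic identifiability -/

section Identifiability

variable {σ M P : Type*}

/-- `Z` is a proper algebraic subset of `Θ`: the set of common zeros in `Θ` of a family of
polynomials, and not all of `Θ`. -/
def IsProperAlgebraicSubset (Θ Z : Set (σ → ℝ)) : Prop :=
  (∃ F : Set (MvPolynomial σ ℝ), Z = {θ ∈ Θ | ∀ f ∈ F, MvPolynomial.eval θ f = 0}) ∧ Z ≠ Θ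

/-- `p` holds at all points of `Θ` outside a proper algebraic subset. -/
def HoldsGenerically (Θ : Set (σ → ℝ)) (p : (σ → ℝ) → Prop) : Prop :=
  ∃ Z, IsProperAlgebraicSubset Θ Z ∧ ∀ θ ∈ Θ \ Z, p θ

/-- The model parametrized by `f` on `Θ` is generically identifiable: the fibre through a generic
point is that point only. -/
def GenericallyIdentifiable (Θ : Set (σ → ℝ)) (f : (σ → ℝ) → M) : Prop :=
  HoldsGenerically Θ fun θ => {θ' ∈ Θ | f θ' = f θ} = {θ}

/-- The part `g` of the parameter is generically identifiable in the model parametrized by `f`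
on `Θ`: it is constant on the fibre through a generic point. -/
def PartGenericallyIdentifiable (Θ : Set (σ → ℝ)) (f : (σ → ℝ) → M) (g : (σ → ℝ) → P) : Prop :=
  HoldsGenerically Θ fun θ => ∀ θ' ∈ Θ, f θ' = f θ → g θ' = g θ

end Identifiability

/-! ### The linear system for the edges into a node -/

section LinearSystem

variable {V : Type*}

/-- The linear system for the weights `x i` of the edges `i → j` into `j`. Here `e k` stands for
a source that is an ancestor of the parent `k` of `j`, and `k₀` is a parent of `j`. There is one
equation for each parent `k ≠ j`, and a further one if `j` has a self-loop; unknowns that do not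
belong to an edge are zero. -/
def SolvesIncomingSystem (G : Digraph V) (A : Matrix V V ℝ) (S : CumulantTensor V 2)
    (T : CumulantTensor V 3) (j : V) (e : V → V) (k₀ : V) (x : V → ℝ) : Prop :=
  (∀ i, ¬ G.Adj i j → x i = 0) ∧
  (∀ k, k ≠ j → G.Adj k j →
    S ![e k, j] = A (e k) (e k) * S ![e k, k] * x k + A (e k) (e k) * S ![e k, j] * x j) ∧
  (G.Adj j j →
    T ![e k₀, e k₀, j] = A (e k₀) (e k₀) ^ 2 * T ![e k₀, e k₀, k₀] * x k₀ +
      A (e k₀) (e k₀) ^ 2 * T ![e k₀, e k₀, j] * x j)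

end LinearSystem

/-! Let `e` be a source and `a` its self-loop weight. Row `e` of `A` is zero off the diagonal, so
the order-`m` cumulant with indices `e, …, e, i` collapses to a discounted sum `D(i) = ∑ₜ w cᵗ
(Aᵗ)ᵢₑ` with `c = a^(m-1)`, and `D = w δₑ + c A D` (`SchurStable.discountedPowerSum_eq`). In a
polytree at most one proper parent `k` of `j` descends from `e`, so along `k → j` this reads `D(j) =
c (b D(k) + d D(j))`, where `b`, `d` are the weights of `k → j` and `j → j`
(`SchurStable.discountedPowerSum_child`).

Take `j` a child of `k = e`. Orders 2, 3 and 4 give three equations, from which `b` and `d` are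
eliminated; the result expresses `a` through cumulants (`source_weight_eq`). Once `a` is known,
orders 2 and 3 form a 2×2 system for `(b, d)` at any edge below `e`, nonsingular because `a ≠ 1` by
stability (`weights_unique`). The Lyapunov equation then returns the error cumulants.

All divisions are legitimate as soon as no edge weight vanishes
(`SchurStable.discountedPowerSum_ne_zero`), so the exceptional set is the zero set of the product of
the edge coordinates. -/

/-! ### Powers of Schur stable matrices -/

/-- Root test in a complex Banach algebra: if the spectrum lies in the open unit disc, the norms
of the powers are summable. -/
theorem summable_norm_pow_of_spectrum_lt_one {B : Type*} [NormedRing B] [NormedAlgebra ℂ B]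
    [CompleteSpace B] (b : B) (hb : ∀ z ∈ spectrum ℂ b, ‖z‖ < 1) :
    Summable fun n : ℕ => ‖b ^ n‖ := by
  nontriviality B
  have h1 : spectralRadius ℂ b < (1 : NNReal) :=
    spectrum.spectralRadius_lt_of_forall_lt b fun z hz => by
      rw [← NNReal.coe_lt_coe]; simpa using hb z hz
  obtain ⟨r, hr0, hr1⟩ := ENNReal.lt_iff_exists_nnreal_btwn.1 h1
  have hr1' : (r : ℝ) < 1 := by exact_mod_cast hr1
  -- Gelfand's formula: eventually `‖bⁿ‖^(1/n) < r < 1`, which allows comparison with a geometric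
  -- series.
  have hlim := (spectrum.pow_nnnorm_pow_one_div_tendsto_nhds_spectralRadius b).eventually
    (gt_mem_nhds hr0)
  refine summable_of_isBigO_nat (summable_geometric_of_lt_one r.2 hr1') ?_
  refine Asymptotics.IsBigO.of_bound 1 ?_
  filter_upwards [hlim, Filter.eventually_gt_atTop 0] with n hn hn0
  have hn0' : (0 : ℝ) < n := by exact_mod_cast hn0
  have h2 : (‖b ^ n‖₊ : ENNReal) ≤ (r : ENNReal) ^ n := by
    have h3 := ENNReal.rpow_le_rpow hn.le hn0'.le
    rwa [← ENNReal.rpow_mul, one_div, inv_mul_cancel₀ hn0'.ne', ENNReal.rpow_one,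
      ENNReal.rpow_natCast] at h3
  have h4 : ‖b ^ n‖ ≤ (r : ℝ) ^ n := by exact_mod_cast h2
  simpa [abs_of_nonneg] using h4

section Stable

variable {V : Type*} [Fintype V] [DecidableEq V]

attribute [local instance] Matrix.linftyOpNormedRing Matrix.linftyOpNormedAlgebra

theorem Matrix.norm_entry_le_linfty_opNorm (B : Matrix V V ℂ) (i j : V) : ‖B i j‖ ≤ ‖B‖ := by
  rw [Matrix.linfty_opNorm_def]
  have h1 : ‖B i j‖₊ ≤ ∑ k, ‖B i k‖₊ :=
    Finset.single_le_sum (f := fun k => ‖B i k‖₊) (fun _ _ => zero_le) (Finset.mem_univ j)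
  have h2 : ∑ k, ‖B i k‖₊ ≤ Finset.univ.sup fun i => ∑ k, ‖B i k‖₊ :=
    Finset.le_sup (f := fun i => ∑ k, ‖B i k‖₊) (Finset.mem_univ i)
  exact_mod_cast h1.trans h2

/-- The entries of the powers of a Schur stable matrix are absolutely summable. -/
theorem SchurStable.summable_pow_entry {A : Matrix V V ℝ} (hA : SchurStable A) (i j : V) :
    Summable fun t : ℕ => |(A ^ t) i j| := by
  refine Summable.of_nonneg_of_le (fun _ => abs_nonneg _) (fun t => ?_)
    (summable_norm_pow_of_spectrum_lt_one (A.map (algebraMap ℝ ℂ)) hA)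
  have h := Matrix.norm_entry_le_linfty_opNorm ((A.map (algebraMap ℝ ℂ)) ^ t) i j
  rw [← Matrix.map_pow] at h ⊢
  simpa using h

/-- A matrix whose entries are small in comparison with its size is Schur stable. -/
theorem schurStable_of_abs_entry_le (A : Matrix V V ℝ) {ε : ℝ} (hε : 0 ≤ ε)
    (hε' : Fintype.card V * ε < 1) (hA : ∀ i j, |A i j| ≤ ε) : SchurStable A := by
  intro z hz
  rcases isEmpty_or_nonempty V with h | h
  · exact absurd hz (by simp [spectrum.of_subsingleton])
  refine (spectrum.norm_le_norm_of_mem hz).trans_lt (lt_of_le_of_lt ?_ hε')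
  lift ε to NNReal using hε
  rw [Matrix.linfty_opNorm_def]
  have h1 : (Finset.univ.sup fun i => ∑ j, ‖(A.map (algebraMap ℝ ℂ)) i j‖₊)
      ≤ Fintype.card V * ε := by
    refine Finset.sup_le fun i _ => ?_
    refine (Finset.sum_le_card_nsmul _ _ ε fun j _ => ?_).trans (by simp [Finset.card_univ])
    rw [← NNReal.coe_le_coe]
    simpa using hA i j
  exact_mod_cast h1

/-- The entries of the powers of a Schur stable matrix are uniformly bounded. -/
theorem SchurStable.exists_abs_pow_entry_le {A : Matrix V V ℝ} (hA : SchurStable A) :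
    ∃ C : ℝ, ∀ (t : ℕ) (i j : V), |(A ^ t) i j| ≤ C := by
  refine ⟨∑ i, ∑ j, ∑' t : ℕ, |(A ^ t) i j|, fun t i j => ?_⟩
  have h0 : ∀ i j, 0 ≤ ∑' t : ℕ, |(A ^ t) i j| := fun i j => tsum_nonneg fun _ => abs_nonneg _
  calc |(A ^ t) i j| ≤ ∑' t : ℕ, |(A ^ t) i j| :=
        (hA.summable_pow_entry i j).le_tsum t fun _ _ => abs_nonneg _
    _ ≤ ∑ j, ∑' t : ℕ, |(A ^ t) i j| :=
        Finset.single_le_sum (f := fun j => ∑' t : ℕ, |(A ^ t) i j|)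
          (fun j _ => h0 i j) (Finset.mem_univ j)
    _ ≤ _ := Finset.single_le_sum (f := fun i => ∑ j, ∑' t : ℕ, |(A ^ t) i j|)
          (fun i _ => Finset.sum_nonneg fun j _ => h0 i j) (Finset.mem_univ i)

/-- If `e` has no incoming edge from another node, its self-loop weight is an eigenvalue. -/
theorem SchurStable.abs_diag_lt_one {A : Matrix V V ℝ} (hA : SchurStable A) {e : V}
    (he : ∀ v, v ≠ e → A e v = 0) : |A e e| < 1 := by
  -- Row `e` of `A e e • 1 - A` is zero, so a right inverse would give `0 = 1` at entry `(e, e)`.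
  have hz : ((A e e : ℝ) : ℂ) ∈ spectrum ℂ (A.map (algebraMap ℝ ℂ)) := by
    rw [spectrum.mem_iff]
    intro hu
    obtain ⟨U, hU⟩ := hu.exists_right_inv
    have h := congrFun (congrFun hU e) e
    rw [Matrix.mul_apply, Finset.sum_eq_zero] at h
    · simp at h
    · intro v _
      rcases eq_or_ne v e with rfl | hv
      · simp [Matrix.algebraMap_matrix_apply]
      · simp [Matrix.algebraMap_matrix_apply, he v hv, hv.symm]
  simpa using hA _ hz

end Stable

/-! ### Steady-state cumulants -/

section Cumulants

variable {V : Type*} [Fintype V] [DecidableEq V]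

theorem tuckerProduct_diagonalTensor (n : ℕ) (w : V → ℝ) (B : Matrix V V ℝ) (k : Fin n → V) :
    tuckerProduct (diagonalTensor n w) B k = ∑ v, w v * ∏ m, B (k m) v := by
  unfold tuckerProduct diagonalTensor
  simp_rw [Finset.sum_mul]
  rw [Finset.sum_comm]
  simp [ite_mul]

theorem tuckerProduct_pow_succ (n : ℕ) (w : V → ℝ) (A : Matrix V V ℝ) (t : ℕ) (k : Fin n → V) :
    tuckerProduct (diagonalTensor n w) (A ^ (t + 1)) k =
      ∑ l : Fin n → V, (∏ m, A (k m) (l m)) * tuckerProduct (diagonalTensor n w) (A ^ t) l := by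
  simp_rw [tuckerProduct_diagonalTensor, Finset.mul_sum]
  rw [Finset.sum_comm]
  refine Finset.sum_congr rfl fun v _ => ?_
  simp_rw [pow_succ', Matrix.mul_apply, Finset.prod_univ_sum, Fintype.piFinset_univ,
    Finset.mul_sum, Finset.prod_mul_distrib]
  exact Finset.sum_congr rfl fun l _ => by ring

/-- One factor of each product is absolutely summable in `t` and the other `n` are bounded; order `n
+ 1` guarantees that the first exists. -/
theorem SchurStable.summable_tuckerProduct {A : Matrix V V ℝ} (hA : SchurStable A) {n : ℕ}
    (w : V → ℝ) (k : Fin (n + 1) → V) :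
    Summable fun t : ℕ => tuckerProduct (diagonalTensor (n + 1) w) (A ^ t) k := by
  obtain ⟨C, hC⟩ := hA.exists_abs_pow_entry_le
  simp_rw [tuckerProduct_diagonalTensor]
  refine summable_sum fun v _ => Summable.mul_left _ ?_
  refine Summable.of_norm_bounded ((hA.summable_pow_entry (k 0) v).mul_right (C ^ n)) fun t => ?_
  rw [Fin.prod_univ_succ, norm_mul, norm_prod]
  refine mul_le_mul_of_nonneg_left ?_ (abs_nonneg _)
  refine (Finset.prod_le_prod (fun _ _ => norm_nonneg _) fun m _ => hC t (k m.succ) v).trans ?_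
  simp

/-- The discrete Lyapunov equation. -/
theorem SchurStable.steadyCumulant_eq {A : Matrix V V ℝ} (hA : SchurStable A) {n : ℕ}
    (w : V → ℝ) (k : Fin (n + 1) → V) :
    steadyCumulant (n + 1) A w k = diagonalTensor (n + 1) w k +
      ∑ l : Fin (n + 1) → V, (∏ m, A (k m) (l m)) * steadyCumulant (n + 1) A w l := by
  unfold steadyCumulant
  rw [(hA.summable_tuckerProduct w k).tsum_eq_zero_add]
  congr 1
  · rw [pow_zero, tuckerProduct, Finset.sum_eq_single k]
    · simp
    · intro l _ hl
      obtain ⟨m, hm⟩ := Function.ne_iff.1 hl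
      exact mul_eq_zero_of_right _
        (Finset.prod_eq_zero (Finset.mem_univ m) (Matrix.one_apply_ne hm.symm))
    · simp
  · simp_rw [tuckerProduct_pow_succ]
    rw [Summable.tsum_finsetSum fun l _ => (hA.summable_tuckerProduct w l).mul_left _]
    simp_rw [tsum_mul_left]

theorem diagonalTensor_const (n : ℕ) (w : V → ℝ) (v : V) :
    diagonalTensor (n + 1) w (fun _ => v) = w v := by
  simp [diagonalTensor, funext_iff]

/-- The error cumulants are determined by the matrix and the steady-state cumulant. -/
theorem SchurStable.eq_of_steadyCumulant_eq {A : Matrix V V ℝ} (hA : SchurStable A) {n : ℕ}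
    {w w' : V → ℝ} (h : steadyCumulant (n + 1) A w = steadyCumulant (n + 1) A w') : w = w' := by
  funext v
  have h1 := hA.steadyCumulant_eq w fun _ : Fin (n + 1) => v
  have h2 := hA.steadyCumulant_eq w' fun _ : Fin (n + 1) => v
  rw [h, diagonalTensor_const] at h1
  rw [diagonalTensor_const] at h2
  linarith

theorem Matrix.pow_apply_of_row {A : Matrix V V ℝ} {e : V} (he : ∀ v, v ≠ e → A e v = 0)
    (t : ℕ) (v : V) : (A ^ t) e v = if v = e then A e e ^ t else 0 := by
  induction t with
  | zero => simp [Matrix.one_apply, eq_comm]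
  | succ t ih =>
    rw [pow_succ', Matrix.mul_apply, Finset.sum_eq_single e]
    · rw [ih, pow_succ']; split <;> simp
    · intro u _ hu; rw [he u hu, zero_mul]
    · simp

/-- The sum `∑ₜ w cᵗ (Aᵗ)ᵢₑ`: for a source `e` and `c` a power of its self-loop weight,
this is the cumulant with one index `i` and all others equal to `e`. -/
noncomputable def discountedPowerSum (A : Matrix V V ℝ) (e : V) (w c : ℝ) (i : V) : ℝ :=
  ∑' t : ℕ, w * (c ^ t * (A ^ t) i e)

/-- Split off `t = 0` and write `Aᵗ⁺¹ = A Aᵗ`. Stability already makes the powers summable, so `|c|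
≤ 1` is enough. -/
theorem SchurStable.discountedPowerSum_eq {A : Matrix V V ℝ} (hA : SchurStable A) (e : V)
    (w : ℝ) {c : ℝ} (hc : |c| ≤ 1) (i : V) :
    discountedPowerSum A e w c i = (if i = e then w else 0) +
      c * ∑ v, A i v * discountedPowerSum A e w c v := by
  have hs : ∀ i, Summable fun t : ℕ => w * (c ^ t * (A ^ t) i e) := fun i => by
    refine Summable.mul_left _ (Summable.of_norm_bounded (hA.summable_pow_entry i e) fun t => ?_)
    rw [norm_mul, norm_pow, Real.norm_eq_abs, Real.norm_eq_abs]
    exact mul_le_of_le_one_left (abs_nonneg _) (pow_le_one₀ (abs_nonneg _) hc)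
  unfold discountedPowerSum
  rw [(hs i).tsum_eq_zero_add]
  congr 1
  · simp [Matrix.one_apply]
  · simp_rw [← tsum_mul_left]
    rw [← Summable.tsum_finsetSum fun v _ => (hs v).mul_left _, ← tsum_mul_left]
    refine tsum_congr fun t => ?_
    rw [pow_succ' A, Matrix.mul_apply, Finset.mul_sum, Finset.mul_sum, Finset.mul_sum]
    exact Finset.sum_congr rfl fun v _ => by ring

theorem discountedPowerSum_eq_zero {A : Matrix V V ℝ} {e i : V} (h : ∀ t, (A ^ t) i e = 0)
    (w c : ℝ) : discountedPowerSum A e w c i = 0 := by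
  simp [discountedPowerSum, h]

variable {A : Matrix V V ℝ} {e : V}

/-- Each index `e` contributes a factor `(A e e)ᵗ` and kills all error terms but that of `e`; here
and in the next two lemmas the discount is `A e e` to the number of such indices. -/
theorem steadyCumulant_two_of_row (he : ∀ v, v ≠ e → A e v = 0) (w : V → ℝ) (i : V) :
    steadyCumulant 2 A w ![e, i] = discountedPowerSum A e (w e) (A e e) i := by
  refine tsum_congr fun t => ?_
  rw [tuckerProduct_diagonalTensor]
  simp [Fin.prod_univ_succ, Matrix.pow_apply_of_row he]

theorem steadyCumulant_three_of_row (he : ∀ v, v ≠ e → A e v = 0) (w : V → ℝ) (i : V) :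
    steadyCumulant 3 A w ![e, e, i] = discountedPowerSum A e (w e) (A e e ^ 2) i := by
  refine tsum_congr fun t => ?_
  rw [tuckerProduct_diagonalTensor]
  simp [Fin.prod_univ_succ, Matrix.pow_apply_of_row he]
  ring_nf; tauto

theorem steadyCumulant_four_of_row (he : ∀ v, v ≠ e → A e v = 0) (w : V → ℝ) (i : V) :
    steadyCumulant 4 A w ![e, e, e, i] = discountedPowerSum A e (w e) (A e e ^ 3) i := by
  refine tsum_congr fun t => ?_
  rw [tuckerProduct_diagonalTensor]
  simp [Fin.prod_univ_succ, Matrix.pow_apply_of_row he]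
  ring_nf; tauto

end Cumulants

/-! ### Directed paths in polytrees -/

namespace Digraph

variable {V : Type*} {G : Digraph V}

theorem IsPolytree.not_isAncestor (hG : G.IsPolytree) {a b : V} (hab : G.Adj a b) (hne : a ≠ b) :
    ¬ G.IsAncestor b a := by
  intro h
  have h' : ∀ {c}, G.IsAncestor b c →
      Relation.ReflTransGen (fun a b => a ≠ b ∧ G.Adj a b) b c := by
    intro c hc
    induction hc with
    | refl => exact .refl
    | @tail x y _ hxy ih =>
      rcases eq_or_ne x y with rfl | hne
      · exact ih
      · exact ih.tail ⟨hne, hxy⟩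
  exact hG.1 a (Relation.TransGen.head' ⟨hne, hab⟩ (h' h))

theorem IsSource.eq_of_isAncestor {e v : V} (he : G.IsSource e) (h : G.IsAncestor v e) : v = e := by
  induction h using Relation.ReflTransGen.head_induction_on with
  | refl => rfl
  | head h1 _ ih => subst ih; exact he _ h1

/-- The condition on the support later shows that the walk avoids any child of `v` other than `v`.
-/
theorem IsAncestor.exists_walk {u v : V} (h : G.IsAncestor u v) :
    ∃ p : G.toSimpleGraphInclusive.Walk u v, ∀ x ∈ p.support, G.IsAncestor x v := by
  induction h using Relation.ReflTransGen.head_induction_on with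
  | refl => exact ⟨.nil, by simp [IsAncestor, Relation.ReflTransGen.refl]⟩
  | @head a b hab hbv ih =>
    obtain ⟨p, hp⟩ := ih
    rcases eq_or_ne a b with rfl | hne
    · exact ⟨p, hp⟩
    · have hadj : G.toSimpleGraphInclusive.Adj a b := by
        simp [toSimpleGraphInclusive, hne, hab]
      refine ⟨.cons hadj p, fun x hx => ?_⟩
      rw [SimpleGraph.Walk.support_cons, List.mem_cons] at hx
      rcases hx with rfl | hx
      · exact Relation.ReflTransGen.head hab hbv
      · exact hp x hx

theorem IsPolytree.exists_path_penultimate (hG : G.IsPolytree) {u k j : V}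
    (huk : G.IsAncestor u k) (hkj : G.Adj k j) (hne : k ≠ j) :
    ∃ p : G.toSimpleGraphInclusive.Path u j, p.1.penultimate = k := by
  classical
  obtain ⟨p, hp⟩ := huk.exists_walk
  have hadj : G.toSimpleGraphInclusive.Adj k j := by
    simp [toSimpleGraphInclusive, hne, hkj]
  -- Otherwise `j` would be an ancestor of its own parent `k`; hence appending `j` keeps the walk a
  -- path.
  have hj : j ∉ p.bypass.support := fun h =>
    hG.not_isAncestor hkj hne (hp j (p.support_bypass_subset_support h))
  exact ⟨⟨p.bypass.concat hadj, p.bypass_isPath.concat hj hadj⟩,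
    SimpleGraph.Walk.penultimate_concat _ _⟩

/-- In a polytree, a node is an ancestor of at most one proper parent of a given node. -/
theorem IsPolytree.parent_unique (hG : G.IsPolytree) {u k i j : V}
    (huk : G.IsAncestor u k) (hkj : G.Adj k j) (hk : k ≠ j)
    (hui : G.IsAncestor u i) (hij : G.Adj i j) (hi : i ≠ j) : i = k := by
  obtain ⟨p, hp⟩ := hG.exists_path_penultimate huk hkj hk
  obtain ⟨q, hq⟩ := hG.exists_path_penultimate hui hij hi
  -- Paths in a forest are unique, so both have the same penultimate node.
  rw [← hp, ← hq, (hG.2.subsingleton_path u j).elim p q]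

/-- Passing repeatedly to proper parents must stop, as `V` is finite and there are no directed
cycles. -/
theorem IsPolytree.exists_source [Finite V] (hG : G.IsPolytree) (v : V) :
    ∃ e, G.IsSource e ∧ G.IsAncestor e v := by
  have : Std.Irrefl (Relation.TransGen fun a b => a ≠ b ∧ G.Adj a b) := ⟨hG.1⟩
  have hwf := Finite.wellFounded_of_trans_of_irrefl
    (Relation.TransGen fun a b => a ≠ b ∧ G.Adj a b)
  induction v using hwf.induction with
  | _ v ih =>
    by_cases hv : G.IsSource v
    · exact ⟨v, hv, .refl⟩
    · simp only [IsSource, not_forall] at hv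
      obtain ⟨u, huv, hne⟩ := hv
      obtain ⟨e, he, heu⟩ := ih u (.single ⟨hne, huv⟩)
      exact ⟨e, he, heu.tail huv⟩

theorem IsSource.exists_child (hiso : G.NoIsolatedNodes) {e : V} (he : G.IsSource e) :
    ∃ c, e ≠ c ∧ G.Adj e c := by
  obtain ⟨w, hw, h | h⟩ := hiso e
  · exact ⟨w, hw.symm, h⟩
  · exact absurd (he w h) hw

end Digraph

/-! ### Cumulants along directed paths from a source -/

/-- The matrix `A` is supported on the edges of `G`. -/
def Digraph.Supports {V : Type*} (G : Digraph V) (A : Matrix V V ℝ) : Prop :=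
  ∀ i j, ¬ G.Adj i j → A j i = 0

theorem Digraph.Supports.source_row {V : Type*} {G : Digraph V} {A : Matrix V V ℝ}
    (hs : G.Supports A) {e : V} (he : G.IsSource e) (v : V) (hv : v ≠ e) : A e v = 0 :=
  hs v e fun h => hv (he v h)

section Paths

variable {V : Type*} [Fintype V] [DecidableEq V] {G : Digraph V} {A : Matrix V V ℝ} {e : V}

theorem Digraph.Supports.pow_apply_eq_zero (hs : G.Supports A) {i : V}
    (h : ¬ G.IsAncestor e i) (t : ℕ) : (A ^ t) i e = 0 := by
  induction t generalizing i with
  | zero =>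
    have hne : i ≠ e := by rintro rfl; exact h .refl
    simp [hne]
  | succ t ih =>
    rw [pow_succ', Matrix.mul_apply]
    refine Finset.sum_eq_zero fun v _ => ?_
    by_cases hv : G.Adj v i
    · rw [ih fun h' => h (h'.tail hv), mul_zero]
    · rw [hs v i hv, zero_mul]

/-- Along an edge `k → j` the sequence of cumulants with a source above `k` satisfies a linear
equation in the weights of `k → j` and `j → j` only. -/
theorem SchurStable.discountedPowerSum_child (hA : SchurStable A) (hs : G.Supports A)
    (hG : G.IsPolytree) (he : G.IsSource e) {k j : V} (hek : G.IsAncestor e k) (hkj : G.Adj k j)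
    (hne : k ≠ j) (w : ℝ) {c : ℝ} (hc : |c| ≤ 1) :
    discountedPowerSum A e w c j = c * (A j k * discountedPowerSum A e w c k +
      A j j * discountedPowerSum A e w c j) := by
  have hje : j ≠ e := by rintro rfl; exact hne (he k hkj)
  conv_lhs => rw [hA.discountedPowerSum_eq e w hc j, if_neg hje, zero_add]
  congr 1
  -- Any other parent of `j` is not a descendant of `e`, by `parent_unique`, so its sum vanishes.
  rw [← Finset.sum_subset (Finset.subset_univ {k, j}), Finset.sum_pair hne]
  intro i _ hi
  simp only [Finset.mem_insert, Finset.mem_singleton, not_or] at hi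
  by_cases hij : G.Adj i j
  · rw [discountedPowerSum_eq_zero, mul_zero]
    exact hs.pow_apply_eq_zero fun h => hi.1 (hG.parent_unique hek hkj hne h hij hi.2)
  · rw [hs i j hij, zero_mul]

/-- Induction along the path: a zero at `e` would force `w = 0`, and a zero at a child would force
one at its parent. -/
theorem SchurStable.discountedPowerSum_ne_zero (hA : SchurStable A) (hs : G.Supports A)
    (hG : G.IsPolytree) (he : G.IsSource e) (hA0 : ∀ i j, G.Adj i j → A j i ≠ 0) {w c : ℝ}
    (hw : w ≠ 0) (hc0 : c ≠ 0) (hc : |c| ≤ 1) {k : V} (hek : G.IsAncestor e k) :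
    discountedPowerSum A e w c k ≠ 0 := by
  induction hek with
  | refl =>
    intro h
    have h1 := hA.discountedPowerSum_eq e w hc e
    rw [Finset.sum_eq_single e, h] at h1
    · simp [hw.symm] at h1
    · intro v _ hv; rw [hs.source_row he v hv, zero_mul]
    · simp
  | @tail u v heu huv ih =>
    rcases eq_or_ne u v with rfl | hne
    · exact ih
    · intro h
      have h1 := hA.discountedPowerSum_child hs hG he heu huv hne w hc
      rw [h, mul_zero, add_zero] at h1
      exact mul_ne_zero hc0 (mul_ne_zero (hA0 u v huv) ih) h1.symm

end Paths

/-! ### Identification of the weights -/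

/-- Linear algebra behind the identification of the weight `b` of an edge and the weight `d` of the
self-loop at its head. -/
theorem weights_unique {a b d x y p q p' q' : ℝ} (ha0 : a ≠ 0) (ha1 : a ≠ 1)
    (hp : p ≠ 0) (hq : q ≠ 0) (hp' : p' ≠ 0)
    (h1 : q = a * (b * p + d * q)) (h2 : q' = a ^ 2 * (b * p' + d * q'))
    (h3 : q = a * (x * p + y * q)) (h4 : q' = a ^ 2 * (x * p' + y * q')) : x = b ∧ y = d := by
  have h5 : (x - b) * p + (y - d) * q = 0 := mul_left_cancel₀ ha0 (by linear_combination h1 - h3)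
  have h6 : (x - b) * p' + (y - d) * q' = 0 :=
    mul_left_cancel₀ (pow_ne_zero 2 ha0) (by linear_combination h2 - h4)
  -- If the determinant vanished, eliminating `b` from `h1` and `h2` would also remove `d` and leave
  -- `(1 - a) q p' = 0`.
  have hdet : p * q' - q * p' ≠ 0 := by
    intro hdet
    have h : (1 - a) * (q * p') = 0 := by
      linear_combination (-a * p') * h1 + p * h2 + (a ^ 2 * d - 1) * hdet
    rcases mul_eq_zero.1 h with h | h
    · exact ha1 (by linarith)
    · exact mul_ne_zero hq hp' h
  have hy : y = d := by
    have h : (y - d) * (p * q' - q * p') = 0 := by linear_combination p * h6 - p' * h5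
    rcases mul_eq_zero.1 h with h | h
    · linarith
    · exact absurd h hdet
  refine ⟨?_, hy⟩
  have h : (x - b) * p = 0 := by linear_combination h5 - q * hy
  rcases mul_eq_zero.1 h with h | h
  · linarith
  · exact absurd h hp

/-- The self-loop weight `a` of a source in terms of the cumulants shared with a child. -/
theorem source_weight_eq {a b d s₀ s₁ t₀ t₁ r₀ r₁ : ℝ} (ha1 : a ≠ 1)
    (hs : s₁ ≠ 0) (ht : t₁ ≠ 0) (hr : r₁ ≠ 0)
    (h1 : s₁ = a * (b * s₀ + d * s₁)) (h2 : t₁ = a ^ 2 * (b * t₀ + d * t₁))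
    (h3 : r₁ = a ^ 3 * (b * r₀ + d * r₁)) :
    (t₀ * r₁ - r₀ * t₁) * s₁ ≠ 0 ∧
      (s₀ * t₁ - t₀ * s₁) * r₁ = a * ((t₀ * r₁ - r₀ * t₁) * s₁) := by
  -- Each pair of consecutive orders is combined so that `d` cancels; comparing the two results
  -- cancels `a² b`. Its nonvanishing follows from the nonzero left side and is not assumed.
  have e1 : (a - 1) * (s₁ * t₁ * r₁) = a ^ 2 * b * ((s₀ * t₁ - t₀ * s₁) * r₁) := by
    linear_combination (a * t₁ * r₁) * h1 - (s₁ * r₁) * h2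
  have e2 : (a - 1) * (s₁ * t₁ * r₁) = a ^ 2 * b * (a * ((t₀ * r₁ - r₀ * t₁) * s₁)) := by
    linear_combination (a * r₁ * s₁) * h2 - (t₁ * s₁) * h3
  have hne : (a - 1) * (s₁ * t₁ * r₁) ≠ 0 :=
    mul_ne_zero (sub_ne_zero.2 ha1) (mul_ne_zero (mul_ne_zero hs ht) hr)
  refine ⟨fun h => hne (by rw [e2, h]; ring), mul_left_cancel₀ (fun h => hne ?_) (e1.symm.trans e2)⟩
  rw [e1, h, zero_mul]

section Identification

variable {V : Type*} [Fintype V] [DecidableEq V] {G : Digraph V} {A A' : Matrix V V ℝ}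
  {w₂ w₃ w₄ w₂' w₃' w₄' : V → ℝ}

theorem SchurStable.abs_pow_source_le (hA : SchurStable A) (hs : G.Supports A) {e : V}
    (he : G.IsSource e) (n : ℕ) : |A e e ^ n| ≤ 1 := by
  rw [abs_pow]
  exact pow_le_one₀ (abs_nonneg _) (hA.abs_diag_lt_one (hs.source_row he)).le

theorem SchurStable.source_ne_one (hA : SchurStable A) (hs : G.Supports A) {e : V}
    (he : G.IsSource e) : A e e ≠ 1 := by
  intro h
  have := hA.abs_diag_lt_one (hs.source_row he)
  simp [h] at this

/-- The weights of the edges into a non-source node solve the linear system. -/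
theorem SchurStable.solvesIncomingSystem (hA : SchurStable A) (hs : G.Supports A)
    (hG : G.IsPolytree) {j k₀ : V} {e : V → V}
    (he : ∀ k, k ≠ j → G.Adj k j → G.IsSource (e k) ∧ G.IsAncestor (e k) k)
    (hk₀ : k₀ ≠ j) (hk₀j : G.Adj k₀ j) :
    SolvesIncomingSystem G A (steadyCumulant 2 A w₂) (steadyCumulant 3 A w₃) j e k₀ (A j) := by
  refine ⟨fun i hi => hs i j hi, fun k hk hkj => ?_, fun _ => ?_⟩
  · obtain ⟨h1, h2⟩ := he k hk hkj
    have h := hA.discountedPowerSum_child hs hG h1 h2 hkj hk (w₂ (e k))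
      (by simpa using hA.abs_pow_source_le hs h1 1)
    simp only [steadyCumulant_two_of_row (hs.source_row h1)]
    linear_combination h
  · obtain ⟨h1, h2⟩ := he k₀ hk₀ hk₀j
    have h := hA.discountedPowerSum_child hs hG h1 h2 hk₀j hk₀ (w₃ (e k₀))
      (hA.abs_pow_source_le hs h1 2)
    simp only [steadyCumulant_three_of_row (hs.source_row h1)]
    linear_combination h

/-- If no edge weight vanishes, the linear system has at most one solution. -/
theorem SchurStable.eq_of_solvesIncomingSystem (hA : SchurStable A) (hs : G.Supports A)
    (hG : G.IsPolytree) (hloop : ∀ v, G.IsSource v → G.Adj v v)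
    (hA0 : ∀ i j, G.Adj i j → A j i ≠ 0) (hw₂ : ∀ v, w₂ v ≠ 0) (hw₃ : ∀ v, w₃ v ≠ 0)
    {j k₀ : V} {e : V → V}
    (he : ∀ k, k ≠ j → G.Adj k j → G.IsSource (e k) ∧ G.IsAncestor (e k) k)
    (hk₀ : k₀ ≠ j) (hk₀j : G.Adj k₀ j) {x : V → ℝ}
    (hx : SolvesIncomingSystem G A (steadyCumulant 2 A w₂) (steadyCumulant 3 A w₃) j e k₀ x) :
    x = A j := by
  obtain ⟨hx0, hx2, hx3⟩ := hx
  obtain ⟨-, hA2, hA3⟩ := hA.solvesIncomingSystem (w₂ := w₂) (w₃ := w₃) hs hG he hk₀ hk₀j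
  have hS : ∀ k v, G.IsSource k → G.IsAncestor k v → steadyCumulant 2 A w₂ ![k, v] ≠ 0 := by
    intro k v hk hkv
    rw [steadyCumulant_two_of_row (hs.source_row hk)]
    exact hA.discountedPowerSum_ne_zero hs hG hk hA0 (hw₂ k) (hA0 k k (hloop k hk))
      (by simpa using hA.abs_pow_source_le hs hk 1) hkv
  have hT : ∀ k v, G.IsSource k → G.IsAncestor k v → steadyCumulant 3 A w₃ ![k, k, v] ≠ 0 := by
    intro k v hk hkv
    rw [steadyCumulant_three_of_row (hs.source_row hk)]
    exact hA.discountedPowerSum_ne_zero hs hG hk hA0 (hw₃ k)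
      (pow_ne_zero 2 (hA0 k k (hloop k hk))) (hA.abs_pow_source_le hs hk 2) hkv
  -- The self-loop weight comes from the 2×2 system at `k₀`; the remaining equations then have one
  -- unknown each.
  have hjj : x j = A j j := by
    by_cases hj : G.Adj j j
    · obtain ⟨h1, h2⟩ := he k₀ hk₀ hk₀j
      refine (weights_unique (q' := steadyCumulant 3 A w₃ ![e k₀, e k₀, j])
        (hA0 _ _ (hloop _ h1)) (hA.source_ne_one hs h1) (hS _ _ h1 h2)
        (hS _ j h1 (h2.tail hk₀j)) (hT _ _ h1 h2)
        ?_ ?_ ?_ ?_ : x k₀ = A j k₀ ∧ x j = A j j).2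
      · linear_combination hA2 k₀ hk₀ hk₀j
      · linear_combination hA3 hj
      · linear_combination hx2 k₀ hk₀ hk₀j
      · linear_combination hx3 hj
    · rw [hx0 j hj, hs j j hj]
  funext i
  rcases eq_or_ne i j with rfl | hi
  · exact hjj
  by_cases hij : G.Adj i j
  · obtain ⟨h1, h2⟩ := he i hi hij
    refine mul_left_cancel₀ (mul_ne_zero (hA0 _ _ (hloop _ h1)) (hS _ _ h1 h2)) ?_
    have e1 := hx2 i hi hij
    rw [hjj] at e1
    linear_combination hA2 i hi hij - e1
  · rw [hx0 i hij, hs i j hij]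

/-- The self-loop weights of the sources are determined by the cumulants. -/
theorem SchurStable.source_weight_unique (hA : SchurStable A) (hs : G.Supports A)
    (hA' : SchurStable A') (hs' : G.Supports A')
    (hG : G.IsPolytree) (hiso : G.NoIsolatedNodes) (hloop : ∀ v, G.IsSource v → G.Adj v v)
    (hA0 : ∀ i j, G.Adj i j → A j i ≠ 0)
    (hw₂ : ∀ v, w₂ v ≠ 0) (hw₃ : ∀ v, w₃ v ≠ 0) (hw₄ : ∀ v, w₄ v ≠ 0)
    (h₂ : steadyCumulant 2 A' w₂' = steadyCumulant 2 A w₂)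
    (h₃ : steadyCumulant 3 A' w₃' = steadyCumulant 3 A w₃)
    (h₄ : steadyCumulant 4 A' w₄' = steadyCumulant 4 A w₄)
    {e : V} (he : G.IsSource e) : A' e e = A e e := by
  obtain ⟨c, hne, hec⟩ := he.exists_child hiso
  have hee : G.IsAncestor e e := .refl
  have hanc : G.IsAncestor e c := .single hec
  have ha := hA0 e e (hloop e he)
  have hb1 : |A e e| ≤ 1 := by simpa using hA.abs_pow_source_le hs he 1
  have hb1' : |A' e e| ≤ 1 := by simpa using hA'.abs_pow_source_le hs' he 1
  have hb := hA.abs_pow_source_le hs he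
  have hb' := hA'.abs_pow_source_le hs' he
  have e2 : ∀ i, discountedPowerSum A' e (w₂' e) (A' e e) i =
      discountedPowerSum A e (w₂ e) (A e e) i := fun i => by
    rw [← steadyCumulant_two_of_row (hs.source_row he), ← h₂,
      steadyCumulant_two_of_row (hs'.source_row he)]
  have e3 : ∀ i, discountedPowerSum A' e (w₃' e) (A' e e ^ 2) i =
      discountedPowerSum A e (w₃ e) (A e e ^ 2) i := fun i => by
    rw [← steadyCumulant_three_of_row (hs.source_row he), ← h₃,
      steadyCumulant_three_of_row (hs'.source_row he)]
  have e4 : ∀ i, discountedPowerSum A' e (w₄' e) (A' e e ^ 3) i =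
      discountedPowerSum A e (w₄ e) (A e e ^ 3) i := fun i => by
    rw [← steadyCumulant_four_of_row (hs.source_row he), ← h₄,
      steadyCumulant_four_of_row (hs'.source_row he)]
  -- Nonvanishing is available for `A` only, since `A'` may have zero weights; equality of the
  -- cumulants transfers it.
  have n2 := hA.discountedPowerSum_ne_zero hs hG he hA0 (hw₂ e) ha hb1 hanc
  have n3 := hA.discountedPowerSum_ne_zero hs hG he hA0 (hw₃ e) (pow_ne_zero 2 ha) (hb 2) hanc
  have n4 := hA.discountedPowerSum_ne_zero hs hG he hA0 (hw₄ e) (pow_ne_zero 3 ha) (hb 3) hanc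
  obtain ⟨hD, hE⟩ := source_weight_eq (hA.source_ne_one hs he) n2 n3 n4
    (hA.discountedPowerSum_child hs hG he hee hec hne _ hb1)
    (hA.discountedPowerSum_child hs hG he hee hec hne _ (hb 2))
    (hA.discountedPowerSum_child hs hG he hee hec hne _ (hb 3))
  have q2 := hA'.discountedPowerSum_child hs' hG he hee hec hne (w₂' e) hb1'
  have q3 := hA'.discountedPowerSum_child hs' hG he hee hec hne (w₃' e) (hb' 2)
  have q4 := hA'.discountedPowerSum_child hs' hG he hee hec hne (w₄' e) (hb' 3)
  rw [e2, e2] at q2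
  rw [e3, e3] at q3
  rw [e4, e4] at q4
  obtain ⟨-, hE'⟩ := source_weight_eq (hA'.source_ne_one hs' he) n2 n3 n4 q2 q3 q4
  exact mul_right_cancel₀ hD (hE'.symm.trans hE)

/-- If no edge weight vanishes, the edge weight matrix is determined by the cumulants. -/
theorem SchurStable.matrix_unique (hA : SchurStable A) (hs : G.Supports A)
    (hA' : SchurStable A') (hs' : G.Supports A')
    (hG : G.IsPolytree) (hiso : G.NoIsolatedNodes) (hloop : ∀ v, G.IsSource v → G.Adj v v)
    (hA0 : ∀ i j, G.Adj i j → A j i ≠ 0)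
    (hw₂ : ∀ v, w₂ v ≠ 0) (hw₃ : ∀ v, w₃ v ≠ 0) (hw₄ : ∀ v, w₄ v ≠ 0)
    (h₂ : steadyCumulant 2 A' w₂' = steadyCumulant 2 A w₂)
    (h₃ : steadyCumulant 3 A' w₃' = steadyCumulant 3 A w₃)
    (h₄ : steadyCumulant 4 A' w₄' = steadyCumulant 4 A w₄) : A' = A := by
  have hsrc : ∀ e, G.IsSource e → A' e e = A e e := fun e he =>
    hA.source_weight_unique hs hA' hs' hG hiso hloop hA0 hw₂ hw₃ hw₄ h₂ h₃ h₄ he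
  funext j
  by_cases hj : G.IsSource j
  · funext i
    rcases eq_or_ne i j with rfl | hi
    · exact hsrc i hj
    · rw [hs.source_row hj i hi, hs'.source_row hj i hi]
  · choose e he hea using hG.exists_source
    simp only [Digraph.IsSource, not_forall] at hj
    obtain ⟨k₀, hk₀j, hk₀⟩ := hj
    have hek : ∀ k, k ≠ j → G.Adj k j → G.IsSource (e k) ∧ G.IsAncestor (e k) k :=
      fun k _ _ => ⟨he k, hea k⟩
    have hsol := hA'.solvesIncomingSystem (w₂ := w₂') (w₃ := w₃') hs' hG hek hk₀ hk₀j
    refine hA.eq_of_solvesIncomingSystem hs hG hloop hA0 hw₂ hw₃ hek hk₀ hk₀j ?_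
    rw [h₂, h₃] at hsol
    -- The system involves the matrix only through self-loop weights of sources, so row `j` of `A'`
    -- solves the system of `A`.
    simpa only [SolvesIncomingSystem, hsrc _ (he _)] using hsol

end Identification

/-! ### Generic parameters -/

section Generic

variable {V : Type*} {G : Digraph V}

theorem LyapunovParam.A_apply (θ : LyapunovParam G) {i j : V} (h : G.Adj i j) :
    LyapunovParam.A θ j i = θ (.edge i j h) := by
  simp [LyapunovParam.A, h]

theorem LyapunovParam.supports (θ : LyapunovParam G) : G.Supports (LyapunovParam.A θ) := by
  intro i j h
  simp [LyapunovParam.A, h]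

theorem LyapunovParam.ext_of_components {θ θ' : LyapunovParam G}
    (hA : LyapunovParam.A θ = LyapunovParam.A θ') (h2 : LyapunovParam.ω2 θ = LyapunovParam.ω2 θ')
    (h3 : LyapunovParam.ω3 θ = LyapunovParam.ω3 θ')
    (h4 : LyapunovParam.ω4 θ = LyapunovParam.ω4 θ') : θ = θ' := by
  funext c
  cases c with
  | edge i j h => rw [← LyapunovParam.A_apply θ h, hA, LyapunovParam.A_apply]
  | omega2 v => exact congrFun h2 v
  | omega3 v => exact congrFun h3 v
  | omega4 v => exact congrFun h4 v

variable [Fintype V] [DecidableEq V]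

theorem exists_mem_lyapunovParamSet_edge_ne_zero (G : Digraph V) :
    ∃ θ ∈ lyapunovParamSet G, ∀ i j, G.Adj i j → LyapunovParam.A θ j i ≠ 0 := by
  classical
  -- Chosen so that `card V * ε < 1`, which bounds the row sums and hence the spectrum.
  set ε : ℝ := ((Fintype.card V : ℝ) + 1)⁻¹ with hε
  have hε0 : 0 < ε := by positivity
  let θ : LyapunovParam G := fun c => match c with
    | .edge _ _ _ => ε
    | .omega2 _ => 1
    | .omega3 _ => 1
    | .omega4 _ => 1
  refine ⟨θ, ⟨schurStable_of_abs_entry_le _ hε0.le ?_ fun j i => ?_, fun v => one_pos,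
    fun v => one_ne_zero, fun v => one_pos⟩, fun i j h => ?_⟩
  · rw [hε, ← div_eq_mul_inv, div_lt_one (by positivity)]
    linarith
  · by_cases h : G.Adj i j
    · rw [LyapunovParam.A_apply θ h]
      exact (abs_of_pos hε0).le
    · rw [LyapunovParam.supports θ i j h, abs_zero]
      exact hε0.le
  · rw [LyapunovParam.A_apply θ h]
    exact hε0.ne'

/-- A property that holds whenever no edge weight vanishes holds generically. -/
theorem holdsGenerically_of_edge_ne_zero {p : LyapunovParam G → Prop}
    (h : ∀ θ ∈ lyapunovParamSet G, (∀ i j, G.Adj i j → LyapunovParam.A θ j i ≠ 0) → p θ) :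
    HoldsGenerically (lyapunovParamSet G) p := by
  classical
  let f : MvPolynomial (LyapunovCoord G) ℝ := ∏ q : V × V,
    if hq : G.Adj q.1 q.2 then MvPolynomial.X (.edge q.1 q.2 hq) else 1
  have hf : ∀ θ : LyapunovParam G, MvPolynomial.eval θ f ≠ 0 ↔
      ∀ i j, G.Adj i j → LyapunovParam.A θ j i ≠ 0 := by
    intro θ
    simp only [f, map_prod, Finset.prod_ne_zero_iff, Finset.mem_univ, true_imp_iff, Prod.forall]
    refine forall₂_congr fun i j => ?_
    by_cases hij : G.Adj i j
    · simp [hij, LyapunovParam.A_apply θ hij]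
    · simp [hij]
  refine ⟨{θ ∈ lyapunovParamSet G | ∀ g ∈ ({f} : Set _), MvPolynomial.eval θ g = 0},
    ⟨⟨{f}, rfl⟩, fun hZ => ?_⟩, fun θ hθ => h θ hθ.1 ?_⟩
  · obtain ⟨θ, hθ, hne⟩ := exists_mem_lyapunovParamSet_edge_ne_zero G
    rw [← hZ] at hθ
    exact (hf θ).2 hne (hθ.2 f rfl)
  · rw [← hf]
    intro h0
    exact hθ.2 ⟨hθ.1, by simpa using h0⟩

end Generic

/-- Only `θ` has to be generic; `θ'` ranges over the whole fibre. -/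
theorem lyapunovMap_A_unique {V : Type*} [Fintype V] [DecidableEq V] {G : Digraph V}
    (hG : G.IsPolytree) (hiso : G.NoIsolatedNodes) (hloop : ∀ v, G.IsSource v → G.Adj v v)
    {θ θ' : LyapunovParam G} (hθ : θ ∈ lyapunovParamSet G)
    (hA0 : ∀ i j, G.Adj i j → LyapunovParam.A θ j i ≠ 0) (hθ' : θ' ∈ lyapunovParamSet G)
    (h : lyapunovMap G θ' = lyapunovMap G θ) : LyapunovParam.A θ' = LyapunovParam.A θ := by
  simp only [lyapunovMap, Prod.mk.injEq] at h
  exact hθ.1.matrix_unique (LyapunovParam.supports θ) hθ'.1 (LyapunovParam.supports θ')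
    hG hiso hloop hA0
    (fun v => (hθ.2.1 v).ne') hθ.2.2.1 (fun v => (hθ.2.2.2 v).ne') h.1 h.2.1 h.2.2

/-- Generic identifiability, from the cumulants of orders two to four, of the edge weight matrix
and of all parameters for polytrees without isolated nodes and with self-loops at all sources;
generically, the edge weights into a non-source node are the only solution of the linear system
formed from the covariances with sources and the third cumulants `t_{eej}`. -/
theorem theorem4p8 {V : Type*} [Fintype V] [DecidableEq V] (G : Digraph V)
    (hp : 2 ≤ Fintype.card V) (hG : G.IsPolytree) (hiso : G.NoIsolatedNodes)
    (hloop : ∀ v, G.IsSource v → G.Adj v v) :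
    PartGenericallyIdentifiable (lyapunovParamSet G) (lyapunovMap G) LyapunovParam.A ∧
    GenericallyIdentifiable (lyapunovParamSet G) (lyapunovMap G) ∧
    HoldsGenerically (lyapunovParamSet G) (fun θ =>
      ∀ (j : V) (e : V → V) (k₀ : V), ¬ G.IsSource j →
        (∀ k, k ≠ j → G.Adj k j → G.IsSource (e k) ∧ G.IsAncestor (e k) k) →
        k₀ ≠ j → G.Adj k₀ j →
        ∀ x : V → ℝ,
          SolvesIncomingSystem G (LyapunovParam.A θ) (lyapunovMap G θ).1 (lyapunovMap G θ).2.1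
            j e k₀ x ↔ ∀ i, x i = LyapunovParam.A θ j i) := by
  refine ⟨holdsGenerically_of_edge_ne_zero fun θ hθ hA0 θ' hθ' h =>
      lyapunovMap_A_unique hG hiso hloop hθ hA0 hθ' h,
    holdsGenerically_of_edge_ne_zero fun θ hθ hA0 => ?_,
    holdsGenerically_of_edge_ne_zero fun θ hθ hA0 j e k₀ _ he hk₀ hk₀j x => ⟨fun hx => ?_, ?_⟩⟩
  · refine Set.eq_singleton_iff_unique_mem.2 ⟨⟨hθ, rfl⟩, fun θ' ⟨hθ', h⟩ => ?_⟩
    have hA := lyapunovMap_A_unique hG hiso hloop hθ hA0 hθ' h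
    simp only [lyapunovMap, hA, Prod.mk.injEq] at h
    -- With `A` fixed, the diagonal entries of the Lyapunov equation recover the error cumulants.
    exact LyapunovParam.ext_of_components hA (hθ.1.eq_of_steadyCumulant_eq h.1)
      (hθ.1.eq_of_steadyCumulant_eq h.2.1) (hθ.1.eq_of_steadyCumulant_eq h.2.2)
  · exact congrFun (hθ.1.eq_of_solvesIncomingSystem (LyapunovParam.supports θ) hG hloop hA0
      (fun v => (hθ.2.1 v).ne') hθ.2.2.1 he hk₀ hk₀j hx)
  · intro hx
    rw [funext hx]
    exact hθ.1.solvesIncomingSystem (LyapunovParam.supports θ) hG he hk₀ hk₀j
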